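/- Let $D\subset\mathbb C^n$ be a bounded symmetric domain containing $0$, that is, a bounded, open, connected set such that every $z_0\in D$ is an isolated fixed point of some involutive biholomorphic self-map of $D$. Let $H(D)$ be the set of holomorphic functions $D\to\mathbb C$, and let $H_z(u,\bar u)=\frac12\sum_{j,k}\frac{\partial^2\log K_D(z,z)}{\partial z_j\,\partial\bar z_k}u_j\bar u_k$ be the Bergman metric of $D$, where $K_D$ is the Bergman kernel of $D$ (with this normalization $H_z(u,\bar u)=|u|^2/(1-|z|^2)^2$ on the unit disk). For $f\in H(D)$ put $$Q_f(z)=\sup_{u\neq0}\frac{\bigl|\sum_j\frac{\partial f}{\partial z_j}(z)\,u_j\bigr|}{H_z(u,\bar u)^{1/2}},\qquad \beta_f=\sup_{z\in D}Q_f(z),\qquad \|f\|_{\mathcal B}=|f(0)|+\beta_f .$$ Let $\mathcal B(D)=\{f\in H(D):\beta_f<\infty\}$ be the Bloch space of $D$ and let $\mathcal B_{0*}(D)=\{f\in H(D):\lim_{z\to\partial^*D}Q_f(z)=0\}$ be its $*$-little Bloch space, where $\partial^*D$ is the distinguished (Shilov) boundary of $D$; both carry the norm $\|\cdot\|_{\mathcal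 B}$. Let $c_D=\sup\{\beta_f: f\in H(D),\ f(D)\subseteq\mathbb D\}$ be the Bloch constant of $D$, where $\mathbb D$ is the open unit disk, and assume that $c_D<1$. For $\psi\in H(D)$ let $M_\psi f=\psi f$. Then, for every $\psi\in H(D)$: (a) $M_\psi$ is an isometry of $\mathcal B(D)$ into itself if and only if $\psi$ is a constant function of modulus one; (b) $M_\psi$ is an isometry of $\mathcal B_{0*}(D)$ into itself if and only if $\psi$ is a constant function of modulus one. -/

import Mathlib

open Set Filter Topology MeasureTheory
open scoped ENNReal ComplexConjugate

noncomputable section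

namespace BlochSpace

/-! ### Bounded symmetric domains in `ℂⁿ` (modelled as `Fin n → ℂ`) -/

/-- `φ` restricts to a biholomorphic self-map of `D`. -/
def IsAutomorphism {n : ℕ} (D : Set (Fin n → ℂ)) (φ : (Fin n → ℂ) → (Fin n → ℂ)) : Prop :=
  DifferentiableOn ℂ φ D ∧ MapsTo φ D D ∧
    ∃ χ : (Fin n → ℂ) → (Fin n → ℂ),
      DifferentiableOn ℂ χ D ∧ MapsTo χ D D ∧ InvOn χ φ D D

/-- `D` is symmetric at `z₀`: some involutive automorphism of `D` has `z₀` as an isolated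
fixed point. -/
def IsSymmetricAt {n : ℕ} (D : Set (Fin n → ℂ)) (z₀ : Fin n → ℂ) : Prop :=
  ∃ φ : (Fin n → ℂ) → (Fin n → ℂ), IsAutomorphism D φ ∧ (∀ z ∈ D, φ (φ z) = z) ∧
    φ z₀ = z₀ ∧ ∃ U ∈ 𝓝 z₀, ∀ z ∈ U ∩ D, φ z = z → z = z₀

/-- A bounded domain (open, connected, nonempty) that is symmetric at each of its points. -/
structure IsBoundedSymmetricDomain {n : ℕ} (D : Set (Fin n → ℂ)) : Prop where
  isOpen : IsOpen D
  isConnected : IsConnected D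
  isBounded : Bornology.IsBounded D
  isSymmetricAt : ∀ z₀ ∈ D, IsSymmetricAt D z₀

/-! ### The Bergman metric -/

/-- The Bergman kernel of `D` on the diagonal,
`K_D(z,z) = sup {|f(z)|² : f holomorphic on D, ∫_D |f|² dV ≤ 1}`, i.e. the squared norm of the
evaluation at `z` on the Bergman space of `D`. It is finite and positive when `D` is a bounded
domain and `z ∈ D`. -/
def bergmanKernelDiag {n : ℕ} (D : Set (Fin n → ℂ)) (z : Fin n → ℂ) : ℝ≥0∞ :=
  ⨆ (f : (Fin n → ℂ) → ℂ) (_ : DifferentiableOn ℂ f D) (_ : ∫⁻ w in D, ‖f w‖ₑ ^ 2 ≤ 1),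
    ‖f z‖ₑ ^ 2

/-- The Wirtinger derivative `∂/∂z_j = ½ (∂/∂x_j - i ∂/∂y_j)`. -/
def wirtinger {n : ℕ} (j : Fin n) (g : (Fin n → ℂ) → ℂ) (z : Fin n → ℂ) : ℂ :=
  (1 / 2 : ℂ) *
    (fderiv ℝ g z (Pi.single j 1) - Complex.I * fderiv ℝ g z (Pi.single j Complex.I))

/-- The conjugate Wirtinger derivative `∂/∂z̄_j = ½ (∂/∂x_j + i ∂/∂y_j)`. -/
def wirtingerBar {n : ℕ} (j : Fin n) (g : (Fin n → ℂ) → ℂ) (z : Fin n → ℂ) : ℂ :=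
  (1 / 2 : ℂ) *
    (fderiv ℝ g z (Pi.single j 1) + Complex.I * fderiv ℝ g z (Pi.single j Complex.I))

/-- The Bergman metric
`H_z(u, v̄) = ½ ∑_{j,k} ∂² log K_D(z,z) / ∂z_j ∂z̄_k · u_j v̄_k`. The factor `½` is the
normalization for which `H_z(u, ū) = |u|² / (1 - |z|²)²` on the unit disk. -/
def bergmanMetric {n : ℕ} (D : Set (Fin n → ℂ)) (z u v : Fin n → ℂ) : ℂ :=
  (1 / 2 : ℂ) * ∑ j, ∑ k,
    wirtinger j (wirtingerBar k fun w => (Real.log (bergmanKernelDiag D w).toReal : ℂ)) z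
      * u j * conj (v k)

/-! ### Bloch functions -/

/-- `Q_f(z) = sup_{u ≠ 0} |∇f(z) u| / H_z(u, ū)^{1/2}`, where `∇f(z) u = ∑_j ∂f/∂z_j(z) u_j`
is the complex derivative of `f` at `z` applied to `u`. -/
def blochQ {n : ℕ} (D : Set (Fin n → ℂ)) (f : (Fin n → ℂ) → ℂ) (z : Fin n → ℂ) : ℝ≥0∞ :=
  ⨆ (u : Fin n → ℂ) (_ : u ≠ 0),
    ‖fderiv ℂ f z u‖ₑ / ENNReal.ofReal (Real.sqrt (bergmanMetric D z u u).re)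

/-- The Bloch seminorm `β_f = sup_{z ∈ D} Q_f(z)`. -/
def blochSeminorm {n : ℕ} (D : Set (Fin n → ℂ)) (f : (Fin n → ℂ) → ℂ) : ℝ≥0∞ :=
  ⨆ z ∈ D, blochQ D f z

/-- The Bloch norm `|f(0)| + β_f`; it is finite exactly when `β_f` is. -/
def blochNorm {n : ℕ} (D : Set (Fin n → ℂ)) (f : (Fin n → ℂ) → ℂ) : ℝ≥0∞ :=
  ‖f 0‖ₑ + blochSeminorm D f

/-- The Bloch space `𝓑(D)`: the holomorphic functions on `D` with `β_f < ∞`. -/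
def blochSpace {n : ℕ} (D : Set (Fin n → ℂ)) : Set ((Fin n → ℂ) → ℂ) :=
  {f | DifferentiableOn ℂ f D ∧ blochSeminorm D f < ∞}

/-- The distinguished (Shilov) boundary `∂*D`: the smallest closed subset of `closure D` on
which `|f|` attains its maximum over `closure D`, for every `f` continuous on `closure D` and
holomorphic on `D`. -/
def distinguishedBoundary {n : ℕ} (D : Set (Fin n → ℂ)) : Set (Fin n → ℂ) :=
  ⋂₀ {S | IsClosed S ∧ S ⊆ closure D ∧
    ∀ f : (Fin n → ℂ) → ℂ, ContinuousOn f (closure D) → DifferentiableOn ℂ f D →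
      ∀ z ∈ closure D, ∃ w ∈ S, ‖f z‖ ≤ ‖f w‖}

/-- The `*`-little Bloch space `𝓑_{0*}(D)`: the holomorphic functions `f` on `D` with
`Q_f(z) → 0` as `z ∈ D` tends to `∂*D`. -/
def starLittleBlochSpace {n : ℕ} (D : Set (Fin n → ℂ)) : Set ((Fin n → ℂ) → ℂ) :=
  {f | DifferentiableOn ℂ f D ∧
    Tendsto (blochQ D f) (𝓝ˢ (distinguishedBoundary D) ⊓ 𝓟 D) (𝓝 0)}

/-- The Bloch constant `c_D = sup {β_f : f holomorphic on D, f(D) ⊆ 𝔻}`. -/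
def blochConstant {n : ℕ} (D : Set (Fin n → ℂ)) : ℝ≥0∞ :=
  ⨆ (f : (Fin n → ℂ) → ℂ) (_ : DifferentiableOn ℂ f D)
    (_ : MapsTo f D (Metric.ball (0 : ℂ) 1)), blochSeminorm D f

/-- The multiplication operator `M_ψ f = ψ f`. -/
def mulOp {n : ℕ} (ψ f : (Fin n → ℂ) → ℂ) : (Fin n → ℂ) → ℂ := fun z => ψ z * f z

/-- `M_ψ` is an isometry on the space `X` of functions on `D`: it is a (linear) map of `X` into
itself that preserves the Bloch norm. -/
def IsIsometryOn {n : ℕ} (D : Set (Fin n → ℂ)) (X : Set ((Fin n → ℂ) → ℂ))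
    (ψ : (Fin n → ℂ) → ℂ) : Prop :=
  MapsTo (mulOp ψ) X X ∧ ∀ f ∈ X, blochNorm D (mulOp ψ f) = blochNorm D f

/-- `ψ` is constant on `D`, with a value of modulus one. -/
def IsUnimodularConstant {n : ℕ} (D : Set (Fin n → ℂ)) (ψ : (Fin n → ℂ) → ℂ) : Prop :=
  ∃ c : ℂ, ‖c‖ = 1 ∧ ∀ z ∈ D, ψ z = c

end BlochSpace

end

namespace BlochSpace

variable {n : ℕ} {D : Set (Fin n → ℂ)} {f ψ : (Fin n → ℂ) → ℂ} {c : ℂ} {z : Fin n → ℂ}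

/-! Both parts rest on one argument, which uses only that the space contains the constant 1.
Iterating the isometry on 1 gives |ψ(0)|^k + β_{ψ^k} = 1 for every k (`IsIsometryOn.blochNorm_pow`).
Since d(ψ^k) = k ψ^{k-1} dψ, the bounds β_{ψ^k} ≤ 1 force dψ = 0 wherever |ψ| > 1; with |ψ(0)| ≤ 1
and connectedness this gives |ψ| ≤ 1 on D. If |ψ| = 1 somewhere, the maximum principle makes ψ
constant. Otherwise every ψ^k with k ≥ 1 maps D into the disk, so 1 ≤ |ψ(0)|^k + c_D with |ψ(0)| <
1, and k → ∞ contradicts c_D < 1. -/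

lemma blochQ_const (c : ℂ) (z : Fin n → ℂ) : blochQ D (fun _ => c) z = 0 := by
  simp [blochQ]

lemma one_mem_blochSpace : (fun _ => 1) ∈ blochSpace D :=
  ⟨differentiableOn_const _, by simp [blochSeminorm, blochQ_const]⟩

lemma one_mem_starLittleBlochSpace : (fun _ => 1) ∈ starLittleBlochSpace D := by
  refine ⟨differentiableOn_const _, ?_⟩
  rw [show blochQ D (fun _ => (1 : ℂ)) = fun _ => 0 from funext (blochQ_const 1)]
  exact tendsto_const_nhds

lemma blochNorm_one : blochNorm D (fun _ => 1) = 1 := by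
  simp [blochNorm, blochSeminorm, blochQ_const]

/-- Multiplying by a function that is a unimodular constant on `D` does not change `Q_f`. -/
lemma blochQ_mulOp_of_eqOn_const (hD : IsOpen D) (hc : ‖c‖ = 1) (hψ : ∀ z ∈ D, ψ z = c)
    (f : (Fin n → ℂ) → ℂ) (hz : z ∈ D) : blochQ D (mulOp ψ f) z = blochQ D f z := by
  have heq : mulOp ψ f =ᶠ[𝓝 z] c • f := by
    filter_upwards [hD.mem_nhds hz] with w hw
    simp [mulOp, hψ w hw]
  have hc' : ‖c‖ₑ = 1 := by rw [← ofReal_norm, hc, ENNReal.ofReal_one]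
  simp only [blochQ, heq.fderiv_eq, fderiv_const_smul_field, smul_apply,
    enorm_smul, hc', one_mul, Pi.smul_apply]

lemma blochSeminorm_mulOp_of_eqOn_const (hD : IsOpen D) (hc : ‖c‖ = 1) (hψ : ∀ z ∈ D, ψ z = c)
    (f : (Fin n → ℂ) → ℂ) : blochSeminorm D (mulOp ψ f) = blochSeminorm D f :=
  biSup_congr fun _ hz => blochQ_mulOp_of_eqOn_const hD hc hψ f hz

lemma blochNorm_mulOp_of_eqOn_const (hD : IsOpen D) (h0 : 0 ∈ D) (hc : ‖c‖ = 1)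
    (hψ : ∀ z ∈ D, ψ z = c) (f : (Fin n → ℂ) → ℂ) :
    blochNorm D (mulOp ψ f) = blochNorm D f := by
  have hc' : ‖c‖ₑ = 1 := by rw [← ofReal_norm, hc, ENNReal.ofReal_one]
  rw [blochNorm, blochNorm, blochSeminorm_mulOp_of_eqOn_const hD hc hψ, mulOp, enorm_mul,
    hψ 0 h0, hc', one_mul]

lemma IsUnimodularConstant.isIsometryOn_blochSpace (h : IsUnimodularConstant D ψ)
    (hD : IsOpen D) (h0 : 0 ∈ D) (hψ : DifferentiableOn ℂ ψ D) :
    IsIsometryOn D (blochSpace D) ψ := by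
  obtain ⟨c, hc, hψc⟩ := h
  refine ⟨fun f hf => ⟨hψ.mul hf.1, ?_⟩,
    fun f _ => blochNorm_mulOp_of_eqOn_const hD h0 hc hψc f⟩
  rw [blochSeminorm_mulOp_of_eqOn_const hD hc hψc]
  exact hf.2

lemma IsUnimodularConstant.isIsometryOn_starLittleBlochSpace (h : IsUnimodularConstant D ψ)
    (hD : IsOpen D) (h0 : 0 ∈ D) (hψ : DifferentiableOn ℂ ψ D) :
    IsIsometryOn D (starLittleBlochSpace D) ψ := by
  obtain ⟨c, hc, hψc⟩ := h
  refine ⟨fun f hf => ⟨hψ.mul hf.1, hf.2.congr' ?_⟩,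
    fun f _ => blochNorm_mulOp_of_eqOn_const hD h0 hc hψc f⟩
  filter_upwards [mem_inf_of_right (mem_principal_self D)] with z hz
  exact (blochQ_mulOp_of_eqOn_const hD hc hψc f hz).symm

/-- The powers of the symbol of an isometric multiplication operator have norm one. -/
lemma IsIsometryOn.blochNorm_pow {X : Set ((Fin n → ℂ) → ℂ)} (h : IsIsometryOn D X ψ)
    (h1 : (fun _ => 1) ∈ X) (k : ℕ) : blochNorm D (fun z => ψ z ^ k) = 1 := by
  have key : (fun z => ψ z ^ k) ∈ X ∧ blochNorm D (fun z => ψ z ^ k) = 1 := by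
    induction k with
    | zero => simpa using ⟨h1, blochNorm_one⟩
    | succ k ih =>
      rw [show (fun z => ψ z ^ (k + 1)) = mulOp ψ fun z => ψ z ^ k from
        funext fun z => pow_succ' _ _]
      exact ⟨h.1 ih.1, (h.2 _ ih.1).trans ih.2⟩
  exact key.2

lemma norm_fderiv_le_of_blochSeminorm_le_one (h : blochSeminorm D f ≤ 1) (hz : z ∈ D)
    (u : Fin n → ℂ) : ‖fderiv ℂ f z u‖ ≤ √(bergmanMetric D z u u).re := by
  rcases eq_or_ne u 0 with rfl | hu
  · simp
  have h1 : ‖fderiv ℂ f z u‖ₑ / ENNReal.ofReal (√(bergmanMetric D z u u).re) ≤ 1 :=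
    (le_iSup₂ (f := fun (u : Fin n → ℂ) (_ : u ≠ 0) =>
      ‖fderiv ℂ f z u‖ₑ / ENNReal.ofReal (√(bergmanMetric D z u u).re)) u hu).trans
      ((le_iSup₂ (f := fun z (_ : z ∈ D) => blochQ D f z) z hz).trans h)
  -- Positivity of the metric is not needed: in `ℝ≥0∞`, a/0 ≤ 1 already forces a = 0.
  have h2 := ENNReal.div_le_iff_le_mul (b := ENNReal.ofReal (√(bergmanMetric D z u u).re))
    (Or.inr ENNReal.one_ne_top) (Or.inl ENNReal.ofReal_ne_top) |>.1 h1
  rwa [one_mul, ← ofReal_norm, ENNReal.ofReal_le_ofReal_iff (Real.sqrt_nonneg _)] at h2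

/-- If all powers of `ψ` have Bloch seminorm at most one, then the derivative of `ψ` vanishes
wherever `|ψ| > 1`. -/
lemma fderiv_eq_zero_of_one_lt_norm (hD : IsOpen D) (hψ : DifferentiableOn ℂ ψ D)
    (h : ∀ k : ℕ, blochSeminorm D (fun z => ψ z ^ k) ≤ 1) (hz : z ∈ D) (h1 : 1 < ‖ψ z‖) :
    fderiv ℂ ψ z = 0 := by
  ext1 u
  by_contra hu
  have hu' : 0 < ‖fderiv ℂ ψ z u‖ := norm_pos_iff.2 hu
  -- For this k, the derivative of ψ^(k+1) along u exceeds the metric bound, since (k+1)|ψ z|^k ≥ k.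
  obtain ⟨k, hk⟩ := exists_nat_gt (√(bergmanMetric D z u u).re / ‖fderiv ℂ ψ z u‖)
  rw [div_lt_iff₀ hu'] at hk
  have hle := norm_fderiv_le_of_blochSeminorm_le_one (h (k + 1)) hz u
  rw [fderiv_fun_pow (k + 1) (hψ.differentiableAt (hD.mem_nhds hz))] at hle
  simp only [add_tsub_cancel_right, smul_apply, nsmul_eq_mul,
    norm_mul, norm_pow, RCLike.norm_natCast, smul_eq_mul] at hle
  have hpow : (k : ℝ) ≤ ((k + 1 : ℕ) : ℝ) * ‖ψ z‖ ^ k := by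
    have := one_le_pow₀ h1.le (n := k)
    push_cast
    nlinarith [k.cast_nonneg (α := ℝ)]
  nlinarith [mul_le_mul_of_nonneg_right hpow hu'.le]

/-- At a point with |ψ| > 1 the level set of ψ is open, because dψ vanishes nearby, and it is
relatively closed by continuity. By connectedness it would contain 0, where |ψ| ≤ 1. -/
lemma norm_le_one_of_forall_blochSeminorm_pow_le_one (hD : IsOpen D) (hconn : IsPreconnected D)
    (hψ : DifferentiableOn ℂ ψ D) (h : ∀ k : ℕ, blochSeminorm D (fun z => ψ z ^ k) ≤ 1)
    (h0 : 0 ∈ D) (hψ0 : ‖ψ 0‖ ≤ 1) : ∀ z ∈ D, ‖ψ z‖ ≤ 1 := by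
  intro z hz
  by_contra! hz1
  have hopen : IsOpen {w ∈ D | ψ w = ψ z} := by
    refine isOpen_iff_mem_nhds.2 fun w hw => ?_
    have hU : IsOpen (D ∩ ψ ⁻¹' {y | 1 < ‖y‖}) :=
      hψ.continuousOn.isOpen_inter_preimage hD (isOpen_lt continuous_const continuous_norm)
    have hwU : w ∈ D ∩ ψ ⁻¹' {y | 1 < ‖y‖} := ⟨hw.1, by simpa [hw.2] using hz1⟩
    obtain ⟨r, hr, hball⟩ := Metric.isOpen_iff.1 hU w hwU
    filter_upwards [Metric.ball_mem_nhds w hr] with v hv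
    refine ⟨(hball hv).1, hw.2 ▸ ?_⟩
    exact Metric.isOpen_ball.is_const_of_fderiv_eq_zero (𝕜 := ℂ)
      (convex_ball w r).isPreconnected (hψ.mono fun y hy => (hball hy).1)
      (fun y hy => fderiv_eq_zero_of_one_lt_norm hD hψ h (hball hy).1 (hball hy).2)
      hv (Metric.mem_ball_self hr)
  have hopen' : IsOpen (D ∩ ψ ⁻¹' {ψ z}ᶜ) :=
    hψ.continuousOn.isOpen_inter_preimage hD isOpen_compl_singleton
  have hsub := hconn.subset_left_of_subset_union hopen hopen'
    (disjoint_left.2 fun w hw hw' => hw'.2 hw.2)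
    (fun w hw => (em (ψ w = ψ z)).imp (⟨hw, ·⟩) (⟨hw, ·⟩)) ⟨z, hz, hz, rfl⟩
  rw [(hsub h0).2] at hψ0
  exact hz1.not_ge hψ0

/-- The symbol of an isometric multiplication operator is a unimodular constant, provided that
the space contains the constants and the Bloch constant is less than one. -/
lemma IsIsometryOn.isUnimodularConstant {X : Set ((Fin n → ℂ) → ℂ)} (h : IsIsometryOn D X ψ)
    (h1 : (fun _ => 1) ∈ X) (hD : IsOpen D) (hconn : IsPreconnected D) (h0 : 0 ∈ D)
    (hc : blochConstant D < 1) (hψ : DifferentiableOn ℂ ψ D) : IsUnimodularConstant D ψ := by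
  have hnorm (k : ℕ) : ‖ψ 0 ^ k‖ₑ + blochSeminorm D (fun z => ψ z ^ k) = 1 :=
    h.blochNorm_pow h1 k
  have hψ0 : ‖ψ 0‖ ≤ 1 := by
    have : ‖ψ 0 ^ 1‖ₑ ≤ 1 := le_self_add.trans (hnorm 1).le
    rwa [pow_one, ← ofReal_norm, ENNReal.ofReal_le_one] at this
  have hle : ∀ z ∈ D, ‖ψ z‖ ≤ 1 := norm_le_one_of_forall_blochSeminorm_pow_le_one hD hconn hψ
    (fun k => le_add_self.trans (hnorm k).le) h0 hψ0
  by_cases hmax : ∃ z ∈ D, ‖ψ z‖ = 1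
  · obtain ⟨z, hz, hz1⟩ := hmax
    exact ⟨ψ z, hz1, Complex.eqOn_of_isPreconnected_of_isMaxOn_norm hconn hD hψ hz
      fun w hw => (hle w hw).trans hz1.ge⟩
  push Not at hmax
  have hlt (z) (hz : z ∈ D) : ‖ψ z‖ < 1 := (hle z hz).lt_of_ne (hmax z hz)
  -- The exponent starts at 1 because ψ^0 = 1 does not map into the open disk.
  have hone (k : ℕ) : 1 ≤ ‖ψ 0‖ₑ ^ (k + 1) + blochConstant D := by
    rw [← hnorm (k + 1), enorm_pow]
    gcongr
    refine le_iSup_of_le _ (le_iSup₂_of_le (hψ.pow (k + 1)) (fun z hz => ?_) le_rfl)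
    simpa using pow_lt_one₀ (norm_nonneg _) (hlt z hz) k.succ_ne_zero
  have hlim : Tendsto (fun k : ℕ => ‖ψ 0‖ₑ ^ (k + 1) + blochConstant D) atTop
      (𝓝 (0 + blochConstant D)) := by
    refine Tendsto.add_const _ ?_
    refine (ENNReal.tendsto_pow_atTop_nhds_zero_of_lt_one ?_).comp (tendsto_add_atTop_nat 1)
    rw [← ofReal_norm, ENNReal.ofReal_lt_one]
    exact hlt 0 h0
  have := ge_of_tendsto' hlim hone
  rw [zero_add] at this
  exact absurd hc this.not_gt

end BlochSpace

theorem mainTheorem5 {n : ℕ} (D : Set (Fin n → ℂ))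
    (hD : BlochSpace.IsBoundedSymmetricDomain D) (h0 : (0 : Fin n → ℂ) ∈ D)
    (hc : BlochSpace.blochConstant D < 1)
    (ψ : (Fin n → ℂ) → ℂ) (hψ : DifferentiableOn ℂ ψ D) :
    (BlochSpace.IsIsometryOn D (BlochSpace.blochSpace D) ψ ↔
      BlochSpace.IsUnimodularConstant D ψ) ∧
    (BlochSpace.IsIsometryOn D (BlochSpace.starLittleBlochSpace D) ψ ↔
      BlochSpace.IsUnimodularConstant D ψ) :=
  ⟨⟨fun h => h.isUnimodularConstant BlochSpace.one_mem_blochSpace hD.isOpen hD.isConnected.isPreconnected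
      h0 hc hψ,
    fun h => h.isIsometryOn_blochSpace hD.isOpen h0 hψ⟩,
   ⟨fun h => h.isUnimodularConstant BlochSpace.one_mem_starLittleBlochSpace hD.isOpen
      hD.isConnected.isPreconnected h0 hc hψ,
    fun h => h.isIsometryOn_starLittleBlochSpace hD.isOpen h0 hψ⟩⟩
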